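/- Theorem (Radial Poisson summation formula). Let $\Gamma$ be a lattice of full rank in $\mathbb{R}^d$, with dual lattice $\Gamma^* = \{x \in \mathbb{R}^d : x\cdot y \in \mathbb{Z} \text{ for all } y \in \Gamma\}$. For $\Lambda\in\{\Gamma,\Gamma^*\}$ let $\eta_\Lambda(r)$ be the (finite) number of points of $\Lambda$ on the sphere $\{x : |x| = r\}$, and let $\mathcal{D}_\Lambda = \{ r \ge 0 : \eta_\Lambda(r) > 0\}$ be the set of radii of non-empty shells. Let $\mu_r$ be the uniform probability measure on the sphere of radius $r$ around the origin, with $\mu_0=\delta_0$, and let $\mathrm{dens}(\Gamma) = \lim_{R\to\infty} \#\{x\in\Gamma : |x|\le R\}/\mathrm{vol}\{x\in\mathbb{R}^d : |x|\le R\}$ be the mean number of points of $\Gamma$ per unit volume. Then this limit exists, the measures $\sum_{r\in\mathcal{D}_\Gamma}\eta_\Gamma(r)\,\mu_r$ and $\sum_{r\in\mathcal{D}_{\Gamma^*}}\eta_{\Gamma^*}(r)\,\mu_r$ are tempered, and, as tempered distributions on $\mathbb{R}^d$, $$\Bigl(\sum_{r\in\mathcal{D}_\Gamma}\eta_\Gamma(r)\,\mu_r\Bigr)^{\wedge}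 = \sum_{r\in\mathcal{D}_\Gamma}\eta_\Gamma(r)\,\widehat{\mu}_r = \mathrm{dens}(\Gamma)\sum_{r\in\mathcal{D}_{\Gamma^*}}\eta_{\Gamma^*}(r)\,\mu_r .$$ Here the middle series converges (unconditionally) in the weak-$*$ topology of the space $\mathcal{S}'(\mathbb{R}^d)$ of tempered distributions, $\widehat{\ \cdot\ }$ is the Fourier transform on $\mathcal{S}'(\mathbb{R}^d)$ that extends $\widehat{\varphi}(k) = \int_{\mathbb{R}^d} e^{-2\pi i k\cdot x}\varphi(x)\,dx$, and, for each $r\in\mathcal{D}_\Gamma$, $\widehat{\mu}_r$ is the distribution given by the function $k\mapsto\int_{\mathbb{R}^d} e^{-2\pi i k\cdot x}\,d\mu_r(x)$. -/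

import Mathlib

open MeasureTheory Filter Topology
open scoped SchwartzMap FourierTransform ENNReal RealInnerProductSpace

namespace RadialPSF

noncomputable section

/-- The dual lattice `{x ∈ ℝᵈ : ⟪x, y⟫ ∈ ℤ for all y ∈ Λ}`; see `mem_dualLattice`. -/
def dualLattice {d : ℕ} (Λ : Submodule ℤ (EuclideanSpace ℝ (Fin d))) :
    Submodule ℤ (EuclideanSpace ℝ (Fin d)) :=
  LinearMap.BilinForm.dualSubmodule (innerₗ (EuclideanSpace ℝ (Fin d))) Λ

theorem mem_dualLattice {d : ℕ} (Λ : Submodule ℤ (EuclideanSpace ℝ (Fin d)))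
    (x : EuclideanSpace ℝ (Fin d)) :
    x ∈ dualLattice Λ ↔ ∀ y ∈ Λ, ∃ n : ℤ, ⟪x, y⟫ = (n : ℝ) := by
  simp [dualLattice, LinearMap.BilinForm.mem_dualSubmodule, Submodule.mem_one, eq_comm]

/-- The points of `Λ` on the centred sphere of radius `r`. -/
def shell {d : ℕ} (Λ : Submodule ℤ (EuclideanSpace ℝ (Fin d))) (r : ℝ) :
    Set (EuclideanSpace ℝ (Fin d)) :=
  (Λ : Set (EuclideanSpace ℝ (Fin d))) ∩ Metric.sphere 0 r

/-- The set of radii of the non-empty shells of `Λ`. -/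
def shellRadii {d : ℕ} (Λ : Submodule ℤ (EuclideanSpace ℝ (Fin d))) : Set ℝ :=
  {r | (shell Λ r).Nonempty}

/-- The shelling number: how many points of `Λ` lie on the centred sphere of radius `r`
(shells of a lattice are finite). -/
def shellNumber {d : ℕ} (Λ : Submodule ℤ (EuclideanSpace ℝ (Fin d))) (r : ℝ) : ℕ :=
  (shell Λ r).ncard

/-- The uniform probability measure on the centred sphere of radius `r ≥ 0` in `ℝᵈ`: the
normalised surface measure of the unit sphere, transported by `x ↦ r x`; for `r = 0` it is the
point mass at the origin. -/
def sphereMeasure (d : ℕ) (r : ℝ) : Measure (EuclideanSpace ℝ (Fin d)) :=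
  if r = 0 then Measure.dirac 0
  else
    ((volume : Measure (EuclideanSpace ℝ (Fin d))).toSphere Set.univ)⁻¹ •
      Measure.map
        (fun x : Metric.sphere (0 : EuclideanSpace ℝ (Fin d)) 1 =>
          r • (x : EuclideanSpace ℝ (Fin d)))
        (volume : Measure (EuclideanSpace ℝ (Fin d))).toSphere

theorem isProbabilityMeasure_sphereMeasure {d : ℕ} (hd : 0 < d) (r : ℝ) :
    IsProbabilityMeasure (sphereMeasure d r) := by
  unfold sphereMeasure
  split_ifs with h
  · infer_instance
  · have : Nonempty (Fin d) := ⟨⟨0, hd⟩⟩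
    have hm : Measurable fun x : Metric.sphere (0 : EuclideanSpace ℝ (Fin d)) 1 =>
        r • (x : EuclideanSpace ℝ (Fin d)) := by fun_prop
    refine ⟨?_⟩
    rw [Measure.smul_apply, Measure.map_apply hm MeasurableSet.univ, Set.preimage_univ, smul_eq_mul]
    exact ENNReal.inv_mul_cancel
      (by rw [Ne, Measure.measure_univ_eq_zero]; exact Measure.toSphere_ne_zero _)
      (measure_ne_top _ _)

instance isFiniteMeasure_sphereMeasure (d : ℕ) (r : ℝ) :
    IsFiniteMeasure (sphereMeasure d r) := by
  rcases Nat.eq_zero_or_pos d with rfl | hd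
  · unfold sphereMeasure
    split_ifs with h
    · infer_instance
    · have h0 : (volume : Measure (EuclideanSpace ℝ (Fin 0))).toSphere = 0 := by
        rw [Measure.toSphere_eq_zero_iff]; infer_instance
      rw [h0]
      simp only [Measure.map_zero, smul_zero]
      infer_instance
  · have := isProbabilityMeasure_sphereMeasure hd r
    infer_instance

/-- The measure `∑ η_Λ(r) μ_r`, summed over the radii `r` of the non-empty shells of `Λ`. -/
def radialComb {d : ℕ} (Λ : Submodule ℤ (EuclideanSpace ℝ (Fin d))) :
    Measure (EuclideanSpace ℝ (Fin d)) :=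
  Measure.sum fun r : shellRadii Λ => (shellNumber Λ r : ℝ≥0∞) • sphereMeasure d r

/-- The point set `X` has density `ρ`: the mean number of points of `X` per unit volume, taken
over centred balls of growing radius, is `ρ`. -/
def HasDensity {d : ℕ} (X : Set (EuclideanSpace ℝ (Fin d))) (ρ : ℝ) : Prop :=
  Tendsto
    (fun R : ℝ => ((X ∩ Metric.closedBall 0 R).ncard : ℝ) /
      (volume : Measure (EuclideanSpace ℝ (Fin d))).real (Metric.closedBall 0 R))
    atTop (𝓝 ρ)

end

end RadialPSF

namespace RadialPSF

noncomputable section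

/-! ### Poisson summation over the integer span of a basis. -/

section Poisson

/-! The formula is the ordinary Poisson summation formula averaged over the orthogonal group.
Grouping by radius makes the radial comb of `Λ` the sum of `μ_‖y‖` over the points `y` of `Λ`, and
`μ_‖y‖` is the law of `g y` for a Haar-random orthogonal `g` (`integral_haarOrthogonal`). So
integrating a Schwartz function `φ` against the comb averages the lattice sums of `φ ∘ g`
(`integral_radialComb`). As `𝓕` commutes with isometries, Poisson summation applied to each `φ ∘ g`
and integrated over `g` gives the identity, with constant the inverse covolume; counting points in
balls shows that this is the density.

Ordinary Poisson summation comes from Fourier series: the periodization of a Schwartz function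
descends to a torus, its coefficients are values of the Fourier transform on the dual lattice
divided by the covolume, and the series is evaluated at 0. -/

/-- A Peetre-type inequality, making decay estimates uniform over translates by bounded `x`. -/
theorem inv_one_add_norm_add_pow_le {E : Type*} [NormedAddCommGroup E] (x y : E)
    (n : ℕ) :
    ((1 + ‖x + y‖) ^ n)⁻¹ ≤ (1 + ‖x‖) ^ n * ((1 + ‖y‖) ^ n)⁻¹ := by
  rw [← div_eq_mul_inv, inv_le_comm₀ (by positivity) (by positivity), inv_div,
    div_le_iff₀ (by positivity), ← mul_pow]
  refine pow_le_pow_left₀ (by positivity) ?_ n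
  have h : ‖y‖ ≤ ‖x + y‖ + ‖x‖ := by simpa using norm_sub_le (x + y) x
  nlinarith [norm_nonneg x, norm_nonneg (x + y)]

theorem preimage_fundamentalDomain {E ι : Type*} [NormedAddCommGroup E] [NormedSpace ℝ E] [Fintype ι]
    (v : Module.Basis ι ℝ E) :
    v.equivFun.symm ⁻¹' ZSpan.fundamentalDomain v =
      Set.univ.pi fun i => Set.Ico ((0 : ι → ℝ) i) ((1 : ι → ℝ) i) := by
  ext t
  simp only [Set.mem_preimage, ZSpan.mem_fundamentalDomain, ← Module.Basis.equivFun_apply,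
    LinearEquiv.apply_symm_apply, Set.mem_univ_pi, Pi.zero_apply, Pi.one_apply]

theorem tsum_translate_add {E : Type*} [NormedAddCommGroup E] (L : Submodule ℤ E) (φ : E → ℂ)
    (x : E) {z : E} (hz : z ∈ L) :
    ∑' y : L, φ (x + z + y) = ∑' y : L, φ (x + y) := by
  rw [← (Equiv.addLeft (⟨z, hz⟩ : L)).tsum_eq fun y : L => φ (x + y)]
  simp [add_assoc]

theorem exists_norm_le_mul_inv_one_add_norm_pow {E : Type*} [NormedAddCommGroup E]
    [NormedSpace ℝ E] (φ : 𝓢(E, ℂ)) (n : ℕ) :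
    ∃ C : ℝ, 0 ≤ C ∧ ∀ x, ‖φ x‖ ≤ C * ((1 + ‖x‖) ^ n)⁻¹ := by
  refine ⟨2 ^ n * ((Finset.Iic (n, 0)).sup fun m => SchwartzMap.seminorm ℝ m.1 m.2) φ,
    by positivity, fun x => ?_⟩
  rw [← div_eq_mul_inv, le_div_iff₀ (by positivity), mul_comm]
  simpa using SchwartzMap.one_add_le_sup_seminorm_apply (𝕜 := ℝ) (m := (n, 0)) le_rfl le_rfl φ x

variable {E : Type*} [NormedAddCommGroup E] [InnerProductSpace ℝ E] [FiniteDimensional ℝ E]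

theorem summable_inv_one_add_norm_pow (L : Submodule ℤ E) [DiscreteTopology L] {n : ℕ}
    (hn : Module.finrank ℤ L < n) : Summable fun y : L => ((1 + ‖(y : E)‖) ^ n)⁻¹ := by
  refine Summable.of_norm_bounded_eventually (ZLattice.summable_norm_pow_inv L n hn) ?_
  -- The comparison with `‖y‖⁻¹ ^ n` fails at `y = 0`, where the inverse takes the value 0.
  have h0 : ∀ᶠ y : L in cofinite, y ≠ 0 := (Set.finite_singleton (0 : L)).compl_mem_cofinite
  filter_upwards [h0] with y hy
  have hy' : 0 < ‖y‖ := norm_pos_iff.mpr hy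
  rw [Real.norm_of_nonneg (by positivity), inv_pow]
  refine inv_anti₀ (by positivity) (pow_le_pow_left₀ hy'.le ?_ n)
  exact le_add_of_nonneg_left zero_le_one

theorem exists_summable_bound_translate (L : Submodule ℤ E) [DiscreteTopology L] (φ : 𝓢(E, ℂ))
    (R : ℝ) : ∃ u : L → ℝ, Summable u ∧ ∀ (y : L) (x : E), ‖x‖ ≤ R → ‖φ (x + y)‖ ≤ u y := by
  set n := Module.finrank ℤ L + 1
  obtain ⟨C, hC, hφ⟩ := exists_norm_le_mul_inv_one_add_norm_pow φ n
  refine ⟨fun y => C * ((1 + R) ^ n * ((1 + ‖(y : E)‖) ^ n)⁻¹),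
    ((summable_inv_one_add_norm_pow L (Nat.lt_succ_self _)).mul_left _).mul_left _,
    fun y x hx => (hφ _).trans (mul_le_mul_of_nonneg_left
      ((inv_one_add_norm_add_pow_le x y n).trans ?_) hC)⟩
  gcongr

theorem continuous_tsum_translate (L : Submodule ℤ E) [DiscreteTopology L] (φ : 𝓢(E, ℂ)) :
    Continuous fun x => ∑' y : L, φ (x + y) := by
  rw [continuous_iff_continuousAt]
  intro x
  obtain ⟨u, hu, hφ⟩ := exists_summable_bound_translate L φ (‖x‖ + 1)
  have h : ContinuousOn (fun x => ∑' y : L, φ (x + y)) (Metric.closedBall 0 (‖x‖ + 1)) :=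
    continuousOn_tsum (fun y => (φ.continuous.comp (by fun_prop)).continuousOn) hu
      fun y z hz => hφ y z (by simpa using hz)
  exact h.continuousAt (Metric.closedBall_mem_nhds_of_mem (by simp))

variable {ι : Type*} [Fintype ι]

theorem mFourier_coe (k : ι → ℤ) (t : ι → ℝ) :
    UnitAddTorus.mFourier k (fun i => (t i : UnitAddCircle)) =
      Complex.exp (2 * Real.pi * Complex.I * (∑ i, k i * t i : ℝ)) := by
  simp only [UnitAddTorus.mFourier, ContinuousMap.coe_mk, fourier_coe_apply]
  rw [← Complex.exp_sum]
  congr 1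
  push_cast
  rw [Finset.mul_sum]
  exact Finset.sum_congr rfl fun i _ => by ring

/-- In the coordinates of `v` the periodization is invariant under integer translations, so it
factors through the quotient map onto the torus. -/
theorem exists_continuousMap_torus_eq_periodization (v : Module.Basis ι ℝ E) (φ : 𝓢(E, ℂ)) :
    ∃ F : C(UnitAddTorus ι, ℂ), ∀ t : ι → ℝ, F (fun i => (t i : UnitAddCircle)) =
      ∑' y : Submodule.span ℤ (Set.range v), φ (v.equivFun.symm t + y) := by
  let q : C(ι → ℝ, UnitAddTorus ι) := ⟨fun t i => (t i : UnitAddCircle), by fun_prop⟩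
  have hq : IsQuotientMap q :=
    (IsOpenQuotientMap.piMap fun _ : ι =>
      QuotientAddGroup.isOpenQuotientMap_mk (N := AddSubgroup.zmultiples (1 : ℝ))).isQuotientMap
  let g : C(ι → ℝ, ℂ) :=
    ⟨fun t => ∑' y : Submodule.span ℤ (Set.range v), φ (v.equivFun.symm t + y),
      (continuous_tsum_translate _ φ).comp v.equivFunL.symm.continuous⟩
  have hg : ∀ s t, q s = q t → g s = g t := by
    intro s t hst
    have h1 : ∀ i, ∃ n : ℤ, n • (1 : ℝ) = s i - t i := fun i => by
      rw [← AddCircle.coe_eq_zero_iff, AddCircle.coe_sub, sub_eq_zero]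
      exact congrFun hst i
    choose n hn using h1
    have h2 : v.equivFun.symm s = v.equivFun.symm t + ∑ i, n i • v i := by
      rw [← sub_eq_iff_eq_add', ← map_sub, Module.Basis.equivFun_symm_apply]
      refine Finset.sum_congr rfl fun i _ => ?_
      rw [Pi.sub_apply, ← hn i, ← Int.cast_smul_eq_zsmul ℝ (n i) (v i), zsmul_one]
    have h3 : ∑ i, n i • v i ∈ Submodule.span ℤ (Set.range v) :=
      Submodule.sum_mem _ fun i _ =>
        Submodule.smul_mem _ _ (Submodule.subset_span (Set.mem_range_self i))
    change ∑' y : Submodule.span ℤ (Set.range v), φ (v.equivFun.symm s + y) = _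
    rw [h2, tsum_translate_add _ _ _ h3]
    rfl
  exact ⟨hq.lift g hg, fun t => congrArg (fun h : C(ι → ℝ, ℂ) => h t) (hq.lift_comp g hg)⟩

variable [MeasurableSpace E] [BorelSpace E]

/-- Both sides are translation-invariant, hence proportional; the constant is read off the
fundamental domain, whose preimage is the unit cube. -/
theorem map_equivFun_symm_volume (v : Module.Basis ι ℝ E) :
    Measure.map v.equivFun.symm (volume : Measure (ι → ℝ)) =
      (volume (ZSpan.fundamentalDomain v))⁻¹ • (volume : Measure E) := by
  classical
  have hm : Measurable v.equivFun.symm :=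
    (LinearMap.continuous_of_finiteDimensional v.equivFun.symm.toLinearMap).measurable
  have : (Measure.map v.equivFun.symm (volume : Measure (ι → ℝ))).IsAddHaarMeasure :=
    v.equivFunL.symm.isAddHaarMeasure_map _
  have h := Measure.isAddLeftInvariant_eq_smul
    (Measure.map v.equivFun.symm (volume : Measure (ι → ℝ))) (volume : Measure E)
  have h1 := congrArg (fun μ => μ (ZSpan.fundamentalDomain v)) h
  simp only [Measure.smul_apply] at h1
  rw [Measure.map_apply hm (ZSpan.fundamentalDomain_measurableSet v)] at h1
  rw [preimage_fundamentalDomain, volume_pi_pi] at h1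
  simp only [Pi.zero_apply, Pi.one_apply, Real.volume_Ico, sub_zero, ENNReal.ofReal_one, Finset.prod_const_one] at h1
  rw [h]
  rw [ENNReal.smul_def, smul_eq_mul] at h1
  rw [← ENNReal.eq_inv_of_mul_eq_one_left h1.symm]
  rfl

theorem setIntegral_Ioc_equivFun_symm (v : Module.Basis ι ℝ E) (h : E → ℂ) :
    ∫ t in {t : ι → ℝ | ∀ i, t i ∈ Set.Ioc ((0 : ι → ℝ) i) ((0 : ι → ℝ) i + 1)},
        h (v.equivFun.symm t) =
      (volume.real (ZSpan.fundamentalDomain v))⁻¹ • ∫ x in ZSpan.fundamentalDomain v, h x := by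
  -- Torus coefficients integrate over `Ioc` boxes, while the fundamental domain is an `Ico` box;
  -- the two differ by a null set.
  have hs : {t : ι → ℝ | ∀ i, t i ∈ Set.Ioc ((0 : ι → ℝ) i) ((0 : ι → ℝ) i + 1)} =ᵐ[volume]
      v.equivFun.symm ⁻¹' ZSpan.fundamentalDomain v := by
    have h3 : {t : ι → ℝ | ∀ i, t i ∈ Set.Ioc ((0 : ι → ℝ) i) ((0 : ι → ℝ) i + 1)} =
        Set.univ.pi fun i => Set.Ioc ((0 : ι → ℝ) i) ((1 : ι → ℝ) i) := by
      ext t; simp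
    rw [preimage_fundamentalDomain, h3]
    exact Measure.univ_pi_Ioc_ae_eq_Icc.trans Measure.univ_pi_Ico_ae_eq_Icc.symm
  have he : MeasurableEmbedding v.equivFun.symm :=
    v.equivFunL.symm.toHomeomorph.measurableEmbedding
  rw [setIntegral_congr_set hs, ← he.setIntegral_map, map_equivFun_symm_volume,
    Measure.restrict_smul, integral_smul_measure, ENNReal.toReal_inv]
  rfl

theorem setIntegral_fundamentalDomain_tsum (v : Module.Basis ι ℝ E) {f : E → ℂ}
    (hf : Integrable f) :
    ∫ x in ZSpan.fundamentalDomain v, ∑' y : Submodule.span ℤ (Set.range v), f (x + y) =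
      ∫ x, f x := by
  have hD := ZSpan.isAddFundamentalDomain' v (volume : Measure E)
  have hc : Countable (Submodule.span ℤ (Set.range v)).toAddSubgroup :=
    inferInstanceAs (Countable (Submodule.span ℤ (Set.range v)))
  have h1 := hD.integral_eq_tsum'' f hf
  rw [h1, ← integral_tsum]
  · refine integral_congr_ae (Eventually.of_forall fun x => ?_)
    exact tsum_congr fun y => congrArg f (add_comm _ _)
  · intro y
    exact ((hf.comp_add_left (y : E)).aestronglyMeasurable).restrict
  · have h2 := hD.lintegral_eq_tsum'' fun x => ‖f x‖ₑ
    rw [← h2]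
    exact hf.hasFiniteIntegral.ne

/-- Since `w` pairs integrally with the lattice, the character is periodic and moves inside the sum;
the integral then unfolds to the whole space. -/
theorem fourier_eq_setIntegral_periodization (v : Module.Basis ι ℝ E) (φ : 𝓢(E, ℂ)) (w : E)
    (hw : ∀ y ∈ Submodule.span ℤ (Set.range v), ∃ n : ℤ, ⟪y, w⟫ = (n : ℝ)) :
    ∫ x in ZSpan.fundamentalDomain v, Complex.exp (-2 * Real.pi * Complex.I * (⟪x, w⟫ : ℝ)) *
        ∑' y : Submodule.span ℤ (Set.range v), φ (x + y) = 𝓕 φ w := by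
  have he : ∀ x, Complex.exp (-2 * Real.pi * Complex.I * (⟪x, w⟫ : ℝ)) * φ x =
      Real.fourierChar (-⟪x, w⟫) • φ x := by
    intro x
    rw [Circle.smul_def, Real.fourierChar_apply, smul_eq_mul]
    congr 2
    push_cast
    ring
  have hi : Integrable fun x => Complex.exp (-2 * Real.pi * Complex.I * (⟪x, w⟫ : ℝ)) * φ x := by
    refine φ.integrable.norm.mono' (by fun_prop) (Eventually.of_forall fun x => ?_)
    rw [he, Circle.norm_smul]
  rw [SchwartzMap.fourier_coe, Real.fourier_eq]
  simp_rw [← he]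
  rw [← setIntegral_fundamentalDomain_tsum v hi]
  refine integral_congr_ae (Eventually.of_forall fun x => ?_)
  beta_reduce
  rw [← tsum_mul_left]
  refine tsum_congr fun y => ?_
  obtain ⟨n, hn⟩ := hw y y.2
  congr 1
  rw [Complex.exp_eq_exp_iff_exists_int]
  refine ⟨n, ?_⟩
  rw [inner_add_left, hn]
  push_cast
  ring

/-- Poisson summation over the lattice spanned by a basis `v`; the point `w k` of the dual lattice
has coordinates `k` with respect to the dual basis. -/
theorem tsum_span_eq_tsum_fourier (v : Module.Basis ι ℝ E) (φ : 𝓢(E, ℂ)) (w : (ι → ℤ) → E)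
    (hw : ∀ k t, ⟪v.equivFun.symm t, w k⟫ = ∑ i, (k i : ℝ) * t i)
    (hs : Summable fun k => 𝓕 φ (w k)) :
    ∑' y : Submodule.span ℤ (Set.range v), φ y =
      (volume.real (ZSpan.fundamentalDomain v))⁻¹ • ∑' k, 𝓕 φ (w k) := by
  obtain ⟨F, hF⟩ := exists_continuousMap_torus_eq_periodization v φ
  have hint : ∀ k, ∀ y ∈ Submodule.span ℤ (Set.range v), ∃ n : ℤ, ⟪y, w k⟫ = (n : ℝ) := by
    classical
    intro k y hy
    induction hy using Submodule.span_induction with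
    | mem y hy =>
      obtain ⟨i, rfl⟩ := hy
      refine ⟨k i, ?_⟩
      have h : v i = v.equivFun.symm (Pi.single i 1) := by
        simp [Module.Basis.equivFun_symm_apply, Pi.single_apply]
      rw [h, hw]
      simp [Pi.single_apply]
    | zero => exact ⟨0, by simp⟩
    | add x y _ _ hx hy =>
      obtain ⟨m, hm⟩ := hx
      obtain ⟨n, hn⟩ := hy
      exact ⟨m + n, by rw [inner_add_left, hm, hn]; push_cast; rfl⟩
    | smul a x _ hx =>
      obtain ⟨m, hm⟩ := hx
      refine ⟨a * m, ?_⟩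
      rw [← Int.cast_smul_eq_zsmul ℝ, real_inner_smul_left, hm]
      push_cast
      rfl
  have hcoeff : ∀ k, UnitAddTorus.mFourierCoeff F k =
      (volume.real (ZSpan.fundamentalDomain v))⁻¹ • 𝓕 φ (w k) := by
    intro k
    rw [UnitAddTorus.mFourierCoeff_eq_integral F k 0,
      ← fourier_eq_setIntegral_periodization v φ (w k) (hint k), ← setIntegral_Ioc_equivFun_symm]
    refine integral_congr_ae (Eventually.of_forall fun t => ?_)
    beta_reduce
    rw [hF, mFourier_coe, hw, smul_eq_mul]
    congr 2
    push_cast [Pi.neg_apply]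
    simp only [neg_mul, Finset.sum_neg_distrib]
    ring
  have hsum : Summable (UnitAddTorus.mFourierCoeff F) := by
    rw [funext hcoeff]
    exact hs.const_smul _
  -- At the origin every character is 1, so the series becomes the sum of the coefficients.
  have h := UnitAddTorus.hasSum_mFourier_series_apply_of_summable hsum
    (fun i => ((0 : ι → ℝ) i : UnitAddCircle))
  rw [hF] at h
  simp only [mFourier_coe, hcoeff] at h
  simp only [map_zero, zero_add, Pi.zero_apply, mul_zero, Finset.sum_const_zero,
    Complex.ofReal_zero, Complex.exp_zero, smul_eq_mul, mul_one] at h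
  rw [← h.tsum_eq, Summable.tsum_const_smul _ hs]

end Poisson

/-! ### Dual bases and Poisson summation for lattices. -/

section DualLattice

variable {d : ℕ}

theorem nondegenerate_innerₗ (E : Type*) [NormedAddCommGroup E] [InnerProductSpace ℝ E] :
    LinearMap.BilinForm.Nondegenerate (innerₗ E) := by
  refine ⟨fun x hx => ?_, fun x hx => ?_⟩
  · exact inner_self_eq_zero.1 (hx x)
  · exact inner_self_eq_zero.1 (hx x)

theorem exists_basis_dualLattice (Γ : Submodule ℤ (EuclideanSpace ℝ (Fin d)))
    [DiscreteTopology Γ] [IsZLattice ℝ Γ] :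
    ∃ (ι : Type) (_ : Fintype ι) (_ : DecidableEq ι)
      (v w : Module.Basis ι ℝ (EuclideanSpace ℝ (Fin d))),
      Submodule.span ℤ (Set.range v) = Γ ∧ Submodule.span ℤ (Set.range w) = dualLattice Γ ∧
        ∀ i j, ⟪v i, w j⟫ = if i = j then 1 else 0 := by
  classical
  let v := (Module.Free.chooseBasis ℤ Γ).ofZLatticeBasis ℝ Γ
  have hv : Submodule.span ℤ (Set.range v) = Γ := (Module.Free.chooseBasis ℤ Γ).ofZLatticeBasis_span ℝ
  have hB := nondegenerate_innerₗ (EuclideanSpace ℝ (Fin d))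
  refine ⟨_, inferInstance, inferInstance, v, LinearMap.BilinForm.dualBasis _ hB v, hv, ?_,
    fun i j => ?_⟩
  · rw [← LinearMap.BilinForm.dualSubmodule_span_of_basis, hv]
    rfl
  · have h := LinearMap.BilinForm.apply_dualBasis_left hB v j i
    rw [real_inner_comm]
    exact h

instance discreteTopology_dualLattice (Γ : Submodule ℤ (EuclideanSpace ℝ (Fin d)))
    [DiscreteTopology Γ] [IsZLattice ℝ Γ] : DiscreteTopology (dualLattice Γ) := by
  obtain ⟨ι, _, _, v, w, -, hw, -⟩ := exists_basis_dualLattice Γ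
  rw [← hw]
  infer_instance

instance isZLattice_dualLattice (Γ : Submodule ℤ (EuclideanSpace ℝ (Fin d)))
    [DiscreteTopology Γ] [IsZLattice ℝ Γ] : IsZLattice ℝ (dualLattice Γ) := by
  obtain ⟨ι, _, _, v, w, -, hw, -⟩ := exists_basis_dualLattice Γ
  exact ⟨by rw [← hw]; exact ZSpan.span_top w⟩

theorem summable_schwartz {E : Type*} [NormedAddCommGroup E] [InnerProductSpace ℝ E]
    [FiniteDimensional ℝ E] (L : Submodule ℤ E) [DiscreteTopology L] (φ : 𝓢(E, ℂ)) :
    Summable fun y : L => φ y := by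
  obtain ⟨u, hu, h⟩ := exists_summable_bound_translate L φ 0
  exact Summable.of_norm_bounded hu fun y => by simpa using h y 0 (by simp)

/-- The Poisson summation formula for lattices and Schwartz functions. -/
theorem tsum_fourier_eq_inv_covolume_smul_tsum_dualLattice
    (Γ : Submodule ℤ (EuclideanSpace ℝ (Fin d))) [DiscreteTopology Γ] [IsZLattice ℝ Γ]
    (φ : 𝓢(EuclideanSpace ℝ (Fin d), ℂ)) :
    ∑' y : Γ, 𝓕 φ y = (ZLattice.covolume Γ)⁻¹ • ∑' y : dualLattice Γ, φ y := by
  obtain ⟨ι, _, _, v, w, hv, hw, hvw⟩ := exists_basis_dualLattice Γ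
  subst hv
  let e : (ι → ℤ) ≃ dualLattice (Submodule.span ℤ (Set.range v)) :=
    ((w.restrictScalars ℤ).equivFun.symm.trans (LinearEquiv.ofEq _ _ hw)).toEquiv
  have he : ∀ k, ((e k : dualLattice _) : EuclideanSpace ℝ (Fin d)) = ∑ i, (k i : ℝ) • w i := by
    intro k
    simp [e, Module.Basis.equivFun_symm_apply, Int.cast_smul_eq_zsmul]
  have hinner : ∀ k t, ⟪v.equivFun.symm t, (e k : EuclideanSpace ℝ (Fin d))⟫ =
      ∑ i, (k i : ℝ) * t i := by
    intro k t
    rw [he, Module.Basis.equivFun_symm_apply, inner_sum]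
    refine Finset.sum_congr rfl fun j _ => ?_
    simp [sum_inner, real_inner_smul_left, real_inner_smul_right, hvw]
  have hs := (e.summable_iff (f := fun y : dualLattice _ => φ y)).2 (summable_schwartz _ φ)
  -- Applied to `𝓕⁻ φ`, so that `φ` itself appears on the dual lattice. As `𝓕⁻ φ y = 𝓕 φ (-y)`, the
  -- other side is reindexed by negation.
  have h := tsum_span_eq_tsum_fourier v (𝓕⁻ φ) (fun k => e k) hinner
  simp only [FourierTransform.fourier_fourierInv_eq] at h
  rw [ZLattice.covolume_eq_measure_fundamentalDomain _ volume
    (ZSpan.isAddFundamentalDomain v volume), ← e.tsum_eq fun y : dualLattice _ => φ y, ← h hs,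
    ← (Equiv.neg (Submodule.span ℤ (Set.range v))).tsum_eq]
  refine tsum_congr fun y => ?_
  simp [SchwartzMap.fourierInv_apply_eq]

end DualLattice

/-! ### Density and covolume. -/

section Density

variable {d : ℕ}

theorem hasDensity_inv_covolume (Γ : Submodule ℤ (EuclideanSpace ℝ (Fin d)))
    [DiscreteTopology Γ] [IsZLattice ℝ Γ] :
    HasDensity (Γ : Set (EuclideanSpace ℝ (Fin d))) (ZLattice.covolume Γ)⁻¹ := by
  unfold HasDensity
  rcases Nat.eq_zero_or_pos d with rfl | hd
  -- Dimension 0 is separate: the scaling parameter `R ^ d` used below would not tend to infinity.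
  · have hcov : ZLattice.covolume Γ =
        (volume : Measure (EuclideanSpace ℝ (Fin 0))).real Set.univ := by
      rw [ZLattice.covolume_eq_measure_fundamentalDomain Γ volume
        (ZLattice.isAddFundamentalDomain (Module.Free.chooseBasis ℤ Γ) volume)]
      congr 1
      have h0 : (0 : EuclideanSpace ℝ (Fin 0)) ∈
          ZSpan.fundamentalDomain ((Module.Free.chooseBasis ℤ Γ).ofZLatticeBasis ℝ Γ) := by
        simp [ZSpan.mem_fundamentalDomain]
      exact Set.eq_univ_of_forall fun x => Subsingleton.elim 0 x ▸ h0
    refine tendsto_const_nhds.congr' ?_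
    filter_upwards [eventually_ge_atTop 0] with R hR
    have h1 : Metric.closedBall (0 : EuclideanSpace ℝ (Fin 0)) R = Set.univ :=
      Set.eq_univ_of_forall fun x => by simp [Subsingleton.elim x 0, hR]
    have h2 : (Γ : Set (EuclideanSpace ℝ (Fin 0))) = {0} := by
      ext x; simp [Subsingleton.elim x 0]
    rw [h1, h2, Set.inter_univ, Set.ncard_singleton, hcov, Nat.cast_one, one_div]
  · have : Nonempty (Fin d) := ⟨⟨0, hd⟩⟩
    have hfin : Module.finrank ℝ (EuclideanSpace ℝ (Fin d)) = d := by simp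
    have hset : {x ∈ (Set.univ : Set (EuclideanSpace ℝ (Fin d))) | ‖x‖ ^ d ≤ 1} =
        Metric.closedBall 0 1 := by
      ext x
      simp [pow_le_one_iff_of_nonneg (norm_nonneg x) hd.ne']
    -- `‖x‖ ^ d` is homogeneous of degree `d`, and its sublevel set at height `R ^ d` is the ball of
    -- radius `R`.
    have h := ZLattice.covolume.tendsto_card_le_div' Γ (X := Set.univ) (F := fun x => ‖x‖ ^ d)
      (fun _ _ _ _ => Set.mem_univ _)
      (fun x r hr => by rw [norm_smul, mul_pow, hfin, Real.norm_of_nonneg hr])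
      (by rw [hset]; exact Metric.isBounded_closedBall)
      (by rw [hset]; exact measurableSet_closedBall)
      (by rw [hset]; rw [frontier_closedBall _ one_ne_zero]; exact Measure.addHaar_sphere _ _ _)
    rw [hset] at h
    set V := (volume : Measure (EuclideanSpace ℝ (Fin d))).real (Metric.closedBall 0 1) with hV
    have hV0 : 0 < V := ENNReal.toReal_pos (Metric.measure_closedBall_pos _ _ one_pos).ne'
      measure_closedBall_lt_top.ne
    have h' := (h.comp (tendsto_pow_atTop hd.ne')).div_const V
    rw [div_div_cancel_left' hV0.ne'] at h'
    refine h'.congr' ?_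
    filter_upwards [eventually_gt_atTop 0] with R hR
    have h1 : (volume : Measure (EuclideanSpace ℝ (Fin d))).real (Metric.closedBall 0 R) =
        R ^ d * V := by
      rw [Measure.addHaar_real_closedBall volume 0 hR.le, hfin, hV,
        Measure.addHaar_real_closedBall volume 0 zero_le_one]
      simp
    have h2 : {x ∈ (Set.univ : Set (EuclideanSpace ℝ (Fin d))) | ‖x‖ ^ d ≤ R ^ d} =
        Metric.closedBall 0 R := by
      ext x
      simp [pow_le_pow_iff_left₀ (norm_nonneg x) hR.le hd.ne']
    rw [h1, Function.comp_apply, h2, div_div, Set.inter_comm]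
    rfl

end Density

/-! ### Rotation invariance of sphere measures. -/

section SphereMeasure

variable {d : ℕ}

open scoped Pointwise in
-- Surface measure is, up to a constant, the volume of the cone over a set; isometries commute with
-- forming cones and preserve volume.
theorem map_sphereMeasure (A : EuclideanSpace ℝ (Fin d) ≃ₗᵢ[ℝ] EuclideanSpace ℝ (Fin d)) (r : ℝ) :
    Measure.map A (sphereMeasure d r) = sphereMeasure d r := by
  have hA : Measurable A := A.continuous.measurable
  unfold sphereMeasure
  split_ifs with hr
  · rw [Measure.map_dirac' hA, map_zero]
  · have hm : Measurable fun x : Metric.sphere (0 : EuclideanSpace ℝ (Fin d)) 1 =>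
        r • (x : EuclideanSpace ℝ (Fin d)) := by fun_prop
    rw [Measure.map_smul]
    congr 1
    ext s hs
    rw [Measure.map_apply hA hs, Measure.map_apply hm (hA hs), Measure.map_apply hm hs,
      Measure.toSphere_apply' _ (hm (hA hs)), Measure.toSphere_apply' _ (hm hs)]
    congr 1
    have h : Set.Ioo (0 : ℝ) 1 • (((↑) : Metric.sphere (0 : EuclideanSpace ℝ (Fin d)) 1 →
            EuclideanSpace ℝ (Fin d)) ''
          ((fun x : Metric.sphere (0 : EuclideanSpace ℝ (Fin d)) 1 =>
            r • (x : EuclideanSpace ℝ (Fin d))) ⁻¹' (A ⁻¹' s))) =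
        A ⁻¹' (Set.Ioo (0 : ℝ) 1 • (((↑) : Metric.sphere (0 : EuclideanSpace ℝ (Fin d)) 1 →
            EuclideanSpace ℝ (Fin d)) ''
          ((fun x : Metric.sphere (0 : EuclideanSpace ℝ (Fin d)) 1 =>
            r • (x : EuclideanSpace ℝ (Fin d))) ⁻¹' s))) := by
      ext x
      simp only [Set.mem_smul, Set.mem_image, Set.mem_preimage]
      constructor
      · rintro ⟨t, ht, _, ⟨u, hu, rfl⟩, rfl⟩
        refine ⟨t, ht, A u, ⟨⟨A u, by simp⟩, ?_, rfl⟩, (map_smul A t _).symm⟩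
        rwa [← map_smul]
      · rintro ⟨t, ht, _, ⟨u, hu, rfl⟩, hx⟩
        refine ⟨t, ht, A.symm u, ⟨⟨A.symm u, by simp⟩, ?_, rfl⟩, ?_⟩
        · simpa using hu
        · rw [← map_smul, hx, A.symm_apply_apply]
    rw [h]
    exact MeasurePreserving.measure_preimage_equiv (f := A.toMeasurableEquiv) A.measurePreserving _

theorem ae_norm_eq_sphereMeasure {r : ℝ} (hr : 0 ≤ r) :
    ∀ᵐ x ∂(sphereMeasure d r), ‖x‖ = r := by
  unfold sphereMeasure
  split_ifs with h
  · rw [ae_dirac_eq]; simp [h]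
  · refine Measure.ae_smul_measure ?_ _
    rw [ae_map_iff (by fun_prop) (measurableSet_eq_fun (by fun_prop) (by fun_prop))]
    exact Eventually.of_forall fun x => by simp [norm_smul, abs_of_nonneg hr]

end SphereMeasure

/-! ### The orthogonal group and its Haar measure. -/

section Orthogonal

variable (E : Type*) [NormedAddCommGroup E] [InnerProductSpace ℝ E] [FiniteDimensional ℝ E]

instance compactSpace_unitary : CompactSpace (unitary (E →L[ℝ] E)) := by
  suffices h : IsCompact (unitary (E →L[ℝ] E) : Set (E →L[ℝ] E)) from
    isCompact_iff_compactSpace.1 h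
  have : ProperSpace (E →L[ℝ] E) := FiniteDimensional.proper ℝ _
  refine Metric.isCompact_of_isClosed_isBounded isClosed_unitary ?_
  refine isBounded_iff_forall_norm_le.2 ⟨1, fun u hu => ?_⟩
  refine ContinuousLinearMap.opNorm_le_bound _ zero_le_one fun x => ?_
  rw [one_mul]
  exact ((Unitary.linearIsometryEquiv (⟨u, hu⟩ : unitary (E →L[ℝ] E))).norm_map x).le

instance measurableSpace_unitary : MeasurableSpace (unitary (E →L[ℝ] E)) := borel _

instance borelSpace_unitary : BorelSpace (unitary (E →L[ℝ] E)) := ⟨rfl⟩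

instance secondCountableTopology_unitary :
    SecondCountableTopology (unitary (E →L[ℝ] E)) := by
  have : ProperSpace (E →L[ℝ] E) := FiniteDimensional.proper ℝ _
  infer_instance

variable {E}

theorem exists_unitary_apply_eq {x y : E} (h : ‖x‖ = ‖y‖) :
    ∃ g : unitary (E →L[ℝ] E), (g : E →L[ℝ] E) x = y := by
  -- The reflection in the hyperplane orthogonal to `x - y` sends `x` to `y`.
  refine ⟨Unitary.linearIsometryEquiv.symm ((Submodule.span ℝ {x - y})ᗮ.reflection), ?_⟩
  rw [Unitary.coe_symm_linearIsometryEquiv_apply]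
  exact Submodule.reflection_sub h

variable (E) in
/-- The normalised Haar measure of the orthogonal group. -/
def haarOrthogonal : Measure (unitary (E →L[ℝ] E)) :=
  Measure.haarMeasure ⊤

instance isProbabilityMeasure_haarOrthogonal : IsProbabilityMeasure (haarOrthogonal E) :=
  ⟨Measure.haarMeasure_self⟩

instance isHaarMeasure_haarOrthogonal : (haarOrthogonal E).IsHaarMeasure :=
  Measure.isHaarMeasure_haarMeasure _

/-- A right translate is again a Haar probability measure, so uniqueness applies. -/
instance isMulRightInvariant_haarOrthogonal : (haarOrthogonal E).IsMulRightInvariant := by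
  refine ⟨fun g => ?_⟩
  have : IsProbabilityMeasure (Measure.map (· * g) (haarOrthogonal E)) :=
    Measure.isProbabilityMeasure_map (by fun_prop)
  exact Measure.isHaarMeasure_eq_of_isProbabilityMeasure _ _

end Orthogonal

/-- The uniform measure on a sphere is the image of the Haar measure of the orthogonal group. -/
theorem integral_haarOrthogonal {d : ℕ} (f : EuclideanSpace ℝ (Fin d) → ℂ)
    (hf : Continuous f) {C : ℝ} (hC : ∀ x, ‖f x‖ ≤ C) (x : EuclideanSpace ℝ (Fin d)) :
    ∫ g, f ((g : EuclideanSpace ℝ (Fin d) →L[ℝ] EuclideanSpace ℝ (Fin d)) x)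
      ∂(haarOrthogonal (EuclideanSpace ℝ (Fin d))) = ∫ y, f y ∂(sphereMeasure d ‖x‖) := by
  rcases eq_or_ne x 0 with rfl | hx
  · simp [sphereMeasure]
  have hd : 0 < d := by
    rcases Nat.eq_zero_or_pos d with rfl | hd
    · exact absurd (Subsingleton.elim x 0) hx
    · exact hd
  have := isProbabilityMeasure_sphereMeasure hd ‖x‖
  -- Writing `y = k x` multiplies `g` by `k` on the right, which right invariance absorbs.
  have hconst : ∀ y : EuclideanSpace ℝ (Fin d), ‖y‖ = ‖x‖ →
      ∫ g, f ((g : EuclideanSpace ℝ (Fin d) →L[ℝ] EuclideanSpace ℝ (Fin d)) y)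
        ∂(haarOrthogonal (EuclideanSpace ℝ (Fin d))) =
      ∫ g, f ((g : EuclideanSpace ℝ (Fin d) →L[ℝ] EuclideanSpace ℝ (Fin d)) x)
        ∂(haarOrthogonal (EuclideanSpace ℝ (Fin d))) := by
    intro y hy
    obtain ⟨k, hk⟩ := exists_unitary_apply_eq hy.symm
    rw [← hk]
    exact integral_mul_right_eq_self (μ := haarOrthogonal (EuclideanSpace ℝ (Fin d)))
      (fun g => f ((g : EuclideanSpace ℝ (Fin d) →L[ℝ] EuclideanSpace ℝ (Fin d)) x)) k
  have hcont : Continuous fun p : EuclideanSpace ℝ (Fin d) ×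
      unitary (EuclideanSpace ℝ (Fin d) →L[ℝ] EuclideanSpace ℝ (Fin d)) =>
        f ((p.2 : EuclideanSpace ℝ (Fin d) →L[ℝ] EuclideanSpace ℝ (Fin d)) p.1) := by fun_prop
  have hint : Integrable (fun p : EuclideanSpace ℝ (Fin d) ×
      unitary (EuclideanSpace ℝ (Fin d) →L[ℝ] EuclideanSpace ℝ (Fin d)) =>
        f ((p.2 : EuclideanSpace ℝ (Fin d) →L[ℝ] EuclideanSpace ℝ (Fin d)) p.1))
      ((sphereMeasure d ‖x‖).prod (haarOrthogonal (EuclideanSpace ℝ (Fin d)))) :=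
    (integrable_const C).mono' hcont.aestronglyMeasurable (Eventually.of_forall fun _ => hC _)
  -- Average the constant over the sphere, exchange the integrals, and use rotation invariance of
  -- the sphere measure.
  calc
    _ = ∫ y, ∫ g, f ((g : EuclideanSpace ℝ (Fin d) →L[ℝ] EuclideanSpace ℝ (Fin d)) y)
        ∂(haarOrthogonal (EuclideanSpace ℝ (Fin d))) ∂(sphereMeasure d ‖x‖) := by
      rw [integral_congr_ae ((ae_norm_eq_sphereMeasure (norm_nonneg x)).mono hconst)]
      simp
    _ = ∫ g, ∫ y, f ((g : EuclideanSpace ℝ (Fin d) →L[ℝ] EuclideanSpace ℝ (Fin d)) y)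
        ∂(sphereMeasure d ‖x‖) ∂(haarOrthogonal (EuclideanSpace ℝ (Fin d))) :=
      integral_integral_swap hint
    _ = ∫ _ : unitary (EuclideanSpace ℝ (Fin d) →L[ℝ] EuclideanSpace ℝ (Fin d)),
        (∫ y, f y ∂(sphereMeasure d ‖x‖)) ∂(haarOrthogonal (EuclideanSpace ℝ (Fin d))) := by
      refine integral_congr_ae (Eventually.of_forall fun g => ?_)
      have h := map_sphereMeasure (Unitary.linearIsometryEquiv g) ‖x‖
      have h2 := integral_map_equiv (μ := sphereMeasure d ‖x‖)
        (Unitary.linearIsometryEquiv g).toMeasurableEquiv f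
      rw [LinearIsometryEquiv.coe_toMeasurableEquiv, h] at h2
      exact h2.symm
    _ = _ := by simp

/-! ### Radial combs as rotational averages. -/

section RadialComb

variable {d : ℕ}

/-- In dimension 0 the sphere measure of a nonzero radius vanishes, but a norm there is always 0. -/
instance isProbabilityMeasure_sphereMeasure_norm (x : EuclideanSpace ℝ (Fin d)) :
    IsProbabilityMeasure (sphereMeasure d ‖x‖) := by
  rcases Nat.eq_zero_or_pos d with rfl | hd
  · rw [Subsingleton.elim x 0, norm_zero, sphereMeasure, if_pos rfl]
    infer_instance
  · exact isProbabilityMeasure_sphereMeasure hd _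

theorem finite_shell (Λ : Submodule ℤ (EuclideanSpace ℝ (Fin d))) [DiscreteTopology Λ] (r : ℝ) :
    (shell Λ r).Finite := by
  have hc : IsClosed (Λ : Set (EuclideanSpace ℝ (Fin d))) :=
    @AddSubgroup.isClosed_of_discrete _ _ _ _ _ Λ.toAddSubgroup
      (inferInstanceAs (DiscreteTopology Λ))
  rw [shell, Set.inter_comm]
  exact Metric.finite_isBounded_inter_isClosed DiscreteTopology.isDiscrete
    Metric.isBounded_sphere hc

theorem tsum_comp_eq_tsum_encard_fiber_mul {α β : Type*} (f : α → β) (c : β → ℝ≥0∞) :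
    ∑' x, c (f x) = ∑' b, ((f ⁻¹' {b}).encard : ℝ≥0∞) * c b := by
  rw [← (Equiv.sigmaFiberEquiv f).tsum_eq, ENNReal.tsum_sigma']
  refine tsum_congr fun b => ?_
  rw [← ENat.card_coe_set_eq, ← ENNReal.tsum_const]
  exact tsum_congr fun x => congrArg c x.2

/-- The radius of the shell on which a point of `Λ` lies. -/
def shellRadius (Λ : Submodule ℤ (EuclideanSpace ℝ (Fin d))) (x : Λ) : shellRadii Λ :=
  ⟨‖(x : EuclideanSpace ℝ (Fin d))‖, x, x.2, mem_sphere_zero_iff_norm.2 rfl⟩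

theorem encard_shellRadius_fiber (Λ : Submodule ℤ (EuclideanSpace ℝ (Fin d)))
    [DiscreteTopology Λ] (r : shellRadii Λ) :
    (shellRadius Λ ⁻¹' {r}).encard = (shellNumber Λ r : ℕ∞) := by
  have h : shell Λ r = Subtype.val '' (shellRadius Λ ⁻¹' {r}) := by
    ext x
    simp [shell, shellRadius, Subtype.ext_iff, and_comm]
  rw [shellNumber, (finite_shell Λ r).cast_ncard_eq, h, Subtype.val_injective.encard_image]

theorem tsum_shellNumber_mul (Λ : Submodule ℤ (EuclideanSpace ℝ (Fin d))) [DiscreteTopology Λ]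
    (c : ℝ → ℝ≥0∞) :
    ∑' r : shellRadii Λ, (shellNumber Λ r : ℝ≥0∞) * c r =
      ∑' x : Λ, c ‖(x : EuclideanSpace ℝ (Fin d))‖ := by
  refine Eq.symm ((tsum_comp_eq_tsum_encard_fiber_mul (shellRadius Λ) fun r => c r).trans ?_)
  refine tsum_congr fun r => ?_
  rw [encard_shellRadius_fiber, ENat.toENNReal_coe]

theorem radialComb_eq_sum (Λ : Submodule ℤ (EuclideanSpace ℝ (Fin d))) [DiscreteTopology Λ] :
    radialComb Λ =
      Measure.sum fun x : Λ => sphereMeasure d ‖(x : EuclideanSpace ℝ (Fin d))‖ := by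
  ext s hs
  rw [radialComb, Measure.sum_apply _ hs, Measure.sum_apply _ hs,
    ← tsum_shellNumber_mul Λ fun r => sphereMeasure d r s]
  rfl

/-- The weight is constant on each sphere, so its integral is a convergent sum over lattice points.
-/
instance hasTemperateGrowth_radialComb (Λ : Submodule ℤ (EuclideanSpace ℝ (Fin d)))
    [DiscreteTopology Λ] [IsZLattice ℝ Λ] : (radialComb Λ).HasTemperateGrowth := by
  refine ⟨Module.finrank ℤ Λ + 1, ?_⟩
  have h : ∀ x : EuclideanSpace ℝ (Fin d),
      (fun y : EuclideanSpace ℝ (Fin d) =>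
        (1 + ‖y‖) ^ (-((Module.finrank ℤ Λ + 1 : ℕ) : ℝ))) =ᵐ[sphereMeasure d ‖x‖]
      fun _ => ((1 + ‖x‖) ^ (Module.finrank ℤ Λ + 1))⁻¹ := fun x => by
    filter_upwards [ae_norm_eq_sphereMeasure (norm_nonneg x)] with y hy
    rw [hy, Real.rpow_neg (by positivity), Real.rpow_natCast]
  rw [radialComb_eq_sum]
  refine integrable_sum_measure (fun x => (integrable_congr (h x)).2 (integrable_const _)) ?_
  refine (summable_inv_one_add_norm_pow Λ (Nat.lt_succ_self _)).congr fun x => ?_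
  refine Eq.symm ((integral_congr_ae ((h x).fun_comp norm)).trans ?_)
  simp [abs_of_nonneg (add_nonneg zero_le_one (norm_nonneg (x : EuclideanSpace ℝ (Fin d))))]

theorem integral_radialComb (Λ : Submodule ℤ (EuclideanSpace ℝ (Fin d))) [DiscreteTopology Λ] [IsZLattice ℝ Λ]
    (φ : 𝓢(EuclideanSpace ℝ (Fin d), ℂ)) :
    ∫ x, φ x ∂(radialComb Λ) =
      ∫ g, ∑' y : Λ, φ ((g : EuclideanSpace ℝ (Fin d) →L[ℝ] EuclideanSpace ℝ (Fin d)) y)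
        ∂(haarOrthogonal (EuclideanSpace ℝ (Fin d))) := by
  have hi : Integrable φ (radialComb Λ) := φ.integrable
  rw [radialComb_eq_sum] at hi ⊢
  obtain ⟨C, -, hC⟩ := exists_norm_le_mul_inv_one_add_norm_pow φ 0
  obtain ⟨D, hD, hφ⟩ := exists_norm_le_mul_inv_one_add_norm_pow φ (Module.finrank ℤ Λ + 1)
  have hb : ∀ x, ‖φ x‖ ≤ C := fun x => by simpa using hC x
  have hcont : ∀ y : Λ, Continuous fun g : unitary (EuclideanSpace ℝ (Fin d) →L[ℝ]
      EuclideanSpace ℝ (Fin d)) =>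
        φ ((g : EuclideanSpace ℝ (Fin d) →L[ℝ] EuclideanSpace ℝ (Fin d)) y) := fun y => by
    fun_prop
  rw [← (hasSum_integral_measure hi).tsum_eq,
    ← integral_tsum_of_summable_integral_norm]
  · exact tsum_congr fun y => (integral_haarOrthogonal φ φ.continuous hb y).symm
  · exact fun y => (integrable_const C).mono' (hcont y).aestronglyMeasurable
      (Eventually.of_forall fun _ => hb _)
  -- The decay bound depends only on `‖g y‖ = ‖y‖`, hence is uniform in `g`; this justifies
  -- exchanging sum and integral.
  · refine Summable.of_nonneg_of_le (fun y => integral_nonneg fun _ => norm_nonneg _)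
      (fun y => ?_) ((summable_inv_one_add_norm_pow Λ (Nat.lt_succ_self _)).mul_left D)
    refine (integral_mono_of_nonneg (Eventually.of_forall fun _ => norm_nonneg _)
      (integrable_const (D * ((1 + ‖(y : EuclideanSpace ℝ (Fin d))‖) ^
        (Module.finrank ℤ Λ + 1))⁻¹)) (Eventually.of_forall fun g => ?_)).trans (by simp)
    have hg : ‖(g : EuclideanSpace ℝ (Fin d) →L[ℝ] EuclideanSpace ℝ (Fin d)) y‖ =
        ‖(y : EuclideanSpace ℝ (Fin d))‖ := (Unitary.linearIsometryEquiv g).norm_map y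
    simpa only [hg] using hφ ((g : EuclideanSpace ℝ (Fin d) →L[ℝ] EuclideanSpace ℝ (Fin d)) y)

theorem integral_fourier_radialComb (Γ : Submodule ℤ (EuclideanSpace ℝ (Fin d)))
    [DiscreteTopology Γ] [IsZLattice ℝ Γ] (φ : 𝓢(EuclideanSpace ℝ (Fin d), ℂ)) :
    ∫ x, 𝓕 φ x ∂(radialComb Γ) =
      (ZLattice.covolume Γ)⁻¹ • ∫ x, φ x ∂(radialComb (dualLattice Γ)) := by
  rw [integral_radialComb, integral_radialComb, ← integral_smul]
  refine integral_congr_ae (Eventually.of_forall fun g => ?_)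
  let A := Unitary.linearIsometryEquiv g
  -- The rotation acts on the test function, so `Γ` and its dual stay fixed.
  have h := tsum_fourier_eq_inv_covolume_smul_tsum_dualLattice Γ
    (SchwartzMap.compCLMOfContinuousLinearEquiv ℂ A.toContinuousLinearEquiv φ)
  refine Eq.trans (tsum_congr fun y => ?_) h
  exact (Real.fourier_comp_linearIsometry A φ (y : EuclideanSpace ℝ (Fin d))).symm

/-- Fubini, after unfolding the Fourier transform of a distribution by duality. -/
theorem fourier_toTemperedDistribution_apply (μ : Measure (EuclideanSpace ℝ (Fin d)))
    [IsFiniteMeasure μ] (φ : 𝓢(EuclideanSpace ℝ (Fin d), ℂ)) :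
    𝓕 μ.toTemperedDistribution φ =
      ∫ k, φ k * ∫ x, Complex.exp (-2 * Real.pi * Complex.I * (⟪k, x⟫ : ℝ)) ∂μ := by
  have he : ∀ k x : EuclideanSpace ℝ (Fin d),
      φ k * Complex.exp (-2 * Real.pi * Complex.I * (⟪k, x⟫ : ℝ)) =
        Real.fourierChar (-⟪k, x⟫) • φ k := by
    intro k x
    rw [Circle.smul_def, Real.fourierChar_apply, smul_eq_mul, mul_comm]
    congr 2
    push_cast
    ring
  have hcont : Continuous fun p : EuclideanSpace ℝ (Fin d) × EuclideanSpace ℝ (Fin d) =>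
      φ p.1 * Complex.exp (-2 * Real.pi * Complex.I * (⟪p.1, p.2⟫ : ℝ)) := by fun_prop
  have hint : Integrable (fun p : EuclideanSpace ℝ (Fin d) × EuclideanSpace ℝ (Fin d) =>
      φ p.1 * Complex.exp (-2 * Real.pi * Complex.I * (⟪p.1, p.2⟫ : ℝ))) (volume.prod μ) := by
    refine ((φ.integrable (μ := volume)).comp_fst μ).norm.mono' hcont.aestronglyMeasurable
      (Eventually.of_forall fun p => ?_)
    rw [he, Circle.norm_smul]
  change ∫ x, 𝓕 φ x ∂μ = _
  simp_rw [← integral_const_mul]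
  rw [integral_integral_swap hint]
  refine integral_congr_ae (Eventually.of_forall fun x => ?_)
  beta_reduce
  rw [SchwartzMap.fourier_coe, Real.fourier_eq]
  simp_rw [he]

/-- Convergence is tested on each `φ`, where it is countable additivity of the integral of `𝓕 φ`,
integrable because the comb is tempered. -/
theorem hasSum_fourier_sphereMeasure (Λ : Submodule ℤ (EuclideanSpace ℝ (Fin d)))
    [DiscreteTopology Λ] [IsZLattice ℝ Λ] :
    HasSum (fun r : shellRadii Λ =>
        (shellNumber Λ r : ℂ) • 𝓕 (sphereMeasure d r).toTemperedDistribution)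
      (𝓕 (radialComb Λ).toTemperedDistribution) := by
  rw [HasSum, PointwiseConvergenceCLM.tendsto_iff_forall_tendsto]
  intro φ
  have h := hasSum_integral_measure (μ := fun r : shellRadii Λ =>
    (shellNumber Λ r : ℝ≥0∞) • sphereMeasure d r) ((𝓕 φ).integrable (μ := radialComb Λ))
  refine Tendsto.congr (fun s => ?_) h
  rw [sum_apply]
  refine Finset.sum_congr rfl fun r _ => ?_
  beta_reduce
  rw [integral_smul_measure, ENNReal.toReal_natCast, Nat.cast_smul_eq_nsmul]
  exact (Nat.cast_smul_eq_nsmul ℂ _ _).symm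

end RadialComb

end

end RadialPSF

/-- Radial Poisson summation formula. The first two components say that both measures are
tempered; `𝓕` is the Fourier transform of tempered distributions, and the sum over `r` converges
in the space of tempered distributions, its terms being the functions
`k ↦ ∫ exp (-2πi ⟪k, x⟫) dμ_r(x)`. -/
theorem mainTheorem1 (d : ℕ) (Γ : Submodule ℤ (EuclideanSpace ℝ (Fin d)))
    [DiscreteTopology Γ] [IsZLattice ℝ Γ] :
    ∃ (_ : (RadialPSF.radialComb Γ).HasTemperateGrowth)
      (_ : (RadialPSF.radialComb (RadialPSF.dualLattice Γ)).HasTemperateGrowth)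
      (dens : ℝ),
      RadialPSF.HasDensity (Γ : Set (EuclideanSpace ℝ (Fin d))) dens ∧
      (∀ r ∈ RadialPSF.shellRadii Γ, ∀ φ : 𝓢(EuclideanSpace ℝ (Fin d), ℂ),
        𝓕 (RadialPSF.sphereMeasure d r).toTemperedDistribution φ =
          ∫ k, φ k * ∫ x, Complex.exp (-2 * Real.pi * Complex.I * (⟪k, x⟫ : ℝ))
            ∂(RadialPSF.sphereMeasure d r)) ∧
      HasSum
        (fun r : RadialPSF.shellRadii Γ =>
          (RadialPSF.shellNumber Γ r : ℂ) •
            𝓕 (RadialPSF.sphereMeasure d r).toTemperedDistribution)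
        (𝓕 (RadialPSF.radialComb Γ).toTemperedDistribution) ∧
      𝓕 (RadialPSF.radialComb Γ).toTemperedDistribution =
        (dens : ℂ) •
          (RadialPSF.radialComb (RadialPSF.dualLattice Γ)).toTemperedDistribution := by
  refine ⟨inferInstance, inferInstance, (ZLattice.covolume Γ)⁻¹,
    RadialPSF.hasDensity_inv_covolume Γ,
    fun r _ φ => RadialPSF.fourier_toTemperedDistribution_apply _ φ,
    RadialPSF.hasSum_fourier_sphereMeasure Γ, ?_⟩
  ext φ
  exact (RadialPSF.integral_fourier_radialComb Γ φ).trans (Complex.coe_smul _ _).symm
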